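/- Let $X$ and $Y$ be locally compact Hausdorff spaces. Let $\mathcal M(X)$ be the set of finite positive regular Borel (Radon) measures on $X$, with the vague topology, i.e. the coarsest topology making $\mu\mapsto\int f\,d\mu$ continuous for every $f\in C_c(X)$ (on measures concentrated on a compact set this is the $w^*$-topology). For $H\subset X$ let $\mathcal M(H)$ be the set of those $\mu\in\mathcal M(X)$ that are concentrated on $H$, i.e. for which every compact set meets $X\setminus H$ in a set of outer $\mu$-measure zero; the same notation is used for $Y$. For a lower semicontinuous kernel $k:X\times Y\to[0,\infty]$, $\mu\in\mathcal M(X)$ and $\nu\in\mathcal M(Y)$ let $$E_k(\mu,\nu)=\sup\Big\{\int_{X\times Y} h\,d(\mu\times\nu) : h\in C_c(X\times Y),\ 0\le h\le k\Big\},$$ and for sets of measures $\mathcal A\subset\mathcal M(X)$, $\mathcal B\subset\mathcal M(Y)$ let $$q_k(\mathcal A,\mathcal B)=\inf_{\mu\in\mathcal A}\sup_{\nu\in\mathcal B}E_k(\mu,\nu),\qquad \underline q_k(\mathcal A,\mathcal B)=\sup_{\mu\in\mathcal A}\inf_{\nu\in\mathcal B}E_k(\mu,\nu).$$ Write $\mathrm{Ex}\,\mathcal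 A$ for the set of extreme points of $\mathcal A$. (i) Let $k:X\times X\to[0,\infty]$ be lower semicontinuous and symmetric, let $H,L\subset X$ be compact, and let $\mathcal R(H)\subset\mathcal M(H)$ and $\tilde{\mathcal R}(L)\subset\mathcal M(L)$ be non-empty, $w^*$-compact and convex. Then $$\underline q_k\big(\mathcal R(H),\mathrm{Ex}\,\tilde{\mathcal R}(L)\big)=q_k\big(\tilde{\mathcal R}(L),\mathrm{Ex}\,\mathcal R(H)\big).$$ (ii) The same holds for two spaces: if $k:X\times Y\to[0,\infty]$ is lower semicontinuous, $H\subset X$ and $L\subset Y$ are compact, and $\mathcal R(H)\subset\mathcal M(H)$, $\tilde{\mathcal R}(L)\subset\mathcal M(L)$ are non-empty, $w^*$-compact and convex, then $$\underline q_k\big(\mathcal R(H),\mathrm{Ex}\,\tilde{\mathcal R}(L)\big)=q_{k^{T}}\big(\tilde{\mathcal R}(L),\mathrm{Ex}\,\mathcal R(H)\big),\qquad k^{T}(y,x)=k(x,y).$$ (iii) In particular, in the situation of (i) with $H=L$ and $\mathcal R(H)=\tilde{\mathcal R}(H)$, $$\underline q_k\big(\mathcal R(H),\mathrm{Ex}\,\mathcal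 R(H)\big)=q_k\big(\mathcal R(H),\mathrm{Ex}\,\mathcal R(H)\big).$$ -/

import Mathlib

open MeasureTheory
open scoped NNReal ENNReal CompactlySupported

namespace SetEnergy

section Measures

variable {X : Type*} [TopologicalSpace X] [MeasurableSpace X] [BorelSpace X]

theorem regular_add [T2Space X] {μ ν : Measure X} [IsFiniteMeasure μ] [IsFiniteMeasure ν]
    (hμ : μ.Regular) (hν : ν.Regular) : (μ + ν).Regular := by
  have hO : (μ + ν).OuterRegular := by
    refine ⟨fun A _ r hr => ?_⟩
    have hfin : (μ + ν) A ≠ ∞ := measure_ne_top _ _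
    obtain ⟨ε, hε, hlt⟩ : ∃ ε : ℝ≥0, 0 < ε ∧ (μ + ν) A + ε < r :=
      ENNReal.lt_iff_exists_add_pos_lt.1 hr
    have hε2 : ((ε / 2 : ℝ≥0) : ℝ≥0∞) ≠ 0 := by
      simpa using hε.ne'
    obtain ⟨U, hAU, hU, hU'⟩ := A.exists_isOpen_le_add μ hε2
    obtain ⟨V, hAV, hV, hV'⟩ := A.exists_isOpen_le_add ν hε2
    refine ⟨U ∩ V, Set.subset_inter hAU hAV, hU.inter hV, lt_of_le_of_lt ?_ hlt⟩
    calc (μ + ν) (U ∩ V) = μ (U ∩ V) + ν (U ∩ V) := by simp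
      _ ≤ μ U + ν V := by
        gcongr
        · exact Set.inter_subset_left
        · exact Set.inter_subset_right
      _ ≤ (μ A + (ε / 2 : ℝ≥0)) + (ν A + (ε / 2 : ℝ≥0)) := add_le_add hU' hV'
      _ = (μ + ν) A + ε := by
        rw [add_add_add_comm, ← ENNReal.coe_add, add_halves]
        simp
  refine { toOuterRegular := hO, innerRegular := fun U hU r hr => ?_ }
  have hr' : r < μ U + ν U := by simpa using hr
  obtain ⟨ε, hε, hlt⟩ : ∃ ε : ℝ≥0, 0 < ε ∧ r + ε < μ U + ν U :=
    ENNReal.lt_iff_exists_add_pos_lt.1 hr'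
  have hε2 : ((ε / 2 : ℝ≥0) : ℝ≥0∞) ≠ 0 := by
    simpa using hε.ne'
  obtain ⟨K, hKU, hK, hK'⟩ :=
    hU.measurableSet.exists_isCompact_lt_add (measure_ne_top μ U) hε2
  obtain ⟨L, hLU, hL, hL'⟩ :=
    hU.measurableSet.exists_isCompact_lt_add (measure_ne_top ν U) hε2
  refine ⟨K ∪ L, Set.union_subset hKU hLU, hK.union hL, ?_⟩
  have h1 : r + ε < (μ + ν) (K ∪ L) + ε := by
    calc r + ε < μ U + ν U := hlt
      _ ≤ (μ K + (ε / 2 : ℝ≥0)) + (ν L + (ε / 2 : ℝ≥0)) := add_le_add hK'.le hL'.le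
      _ = μ K + ν L + ε := by
        rw [add_add_add_comm, ← ENNReal.coe_add, add_halves]
      _ ≤ μ (K ∪ L) + ν (K ∪ L) + ε := by
        gcongr
        · exact Set.subset_union_left
        · exact Set.subset_union_right
      _ = (μ + ν) (K ∪ L) + ε := by simp
  exact lt_of_add_lt_add_right h1

/-- The cone `𝓜(X)` of finite, positive, regular Borel measures on `X`, as a
submodule over the nonnegative reals of all measures. -/
def radonCone (X : Type*) [TopologicalSpace X] [T2Space X] [MeasurableSpace X] [BorelSpace X] :
    Submodule ℝ≥0 (Measure X) where
  carrier := {μ | IsFiniteMeasure μ ∧ μ.Regular}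
  zero_mem' := ⟨inferInstance, inferInstance⟩
  add_mem' := by
    rintro μ ν ⟨hμ, hμ'⟩ ⟨hν, hν'⟩
    exact ⟨inferInstance, regular_add hμ' hν'⟩
  smul_mem' := by
    rintro c μ ⟨hμ, hμ'⟩
    exact ⟨inferInstance, inferInstance⟩

/-- `𝓜(X)` as a type: finite, positive, regular Borel measures on `X`. -/
abbrev RadonMeasure (X : Type*) [TopologicalSpace X] [T2Space X] [MeasurableSpace X]
    [BorelSpace X] : Type _ :=
  ↥(radonCone X)

variable [T2Space X]

/-- The vague topology: the coarsest topology for which `μ ↦ ∫ f dμ` is continuous for every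
continuous compactly supported `f`. On the measures concentrated on a fixed compact set `K` it is
the weak-star topology determined by `C(K)`. -/
noncomputable instance vagueTopology : TopologicalSpace (RadonMeasure X) :=
  TopologicalSpace.induced
    (fun (μ : RadonMeasure X) (f : C_c(X, ℝ)) => ∫ x, f x ∂(μ : Measure X))
    Pi.topologicalSpace

/-- `𝓜(H)`: the measures in `𝓜(X)` concentrated on `H`, i.e. each compact set meets the complement
of `H` in a set of outer measure zero. -/
def measuresOn (H : Set X) : Set (RadonMeasure X) :=
  {μ | ∀ K : Set X, IsCompact K → (μ : Measure X) (K ∩ Hᶜ) = 0}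

end Measures

section Energy

variable {X Y : Type*} [TopologicalSpace X] [T2Space X] [MeasurableSpace X] [BorelSpace X]
  [TopologicalSpace Y] [T2Space Y] [MeasurableSpace Y] [BorelSpace Y]

/-- The mutual energy `E(μ, ν) = ∫ k d(μ × ν)`, as an upper integral: the supremum of
`∫ h d(μ × ν)` over the continuous compactly supported `h` with `0 ≤ h ≤ k`. -/
noncomputable def energy (k : X × Y → ℝ≥0∞) (μ : RadonMeasure X) (ν : RadonMeasure Y) : ℝ≥0∞ :=
  ⨆ (h : C_c(X × Y, ℝ)) (_ : ∀ z, 0 ≤ h z ∧ ENNReal.ofReal (h z) ≤ k z),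
    ∫⁻ z, ENNReal.ofReal (h z) ∂((μ : Measure X).prod (ν : Measure Y))

/-- `q(R, S) = inf_{μ ∈ R} sup_{ν ∈ S} E(μ, ν)`. -/
noncomputable def upperQ (k : X × Y → ℝ≥0∞) (R : Set (RadonMeasure X)) (S : Set (RadonMeasure Y)) :
    ℝ≥0∞ :=
  ⨅ μ ∈ R, ⨆ ν ∈ S, energy k μ ν

/-- `q̲(R, S) = sup_{μ ∈ R} inf_{ν ∈ S} E(μ, ν)`. -/
noncomputable def lowerQ (k : X × Y → ℝ≥0∞) (R : Set (RadonMeasure X)) (S : Set (RadonMeasure Y)) :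
    ℝ≥0∞ :=
  ⨆ μ ∈ R, ⨅ ν ∈ S, energy k μ ν

/-- `Ex R`, the extreme points of a set of measures. -/
def Ex (R : Set (RadonMeasure X)) : Set (RadonMeasure X) :=
  R.extremePoints ℝ≥0

end Energy

end SetEnergy

open SetEnergy

namespace SetEnergy

/-! Both sides equal one minimax value over the full sets `R` and `R'`. For a fixed test function `0
≤ h ≤ k`, `pairing h μ ν` is affine and vaguely continuous in each variable, so Sion's theorem
exchanges inf and sup (`minimax_radonMeasure`). The energy is the directed supremum of these
pairings, and compactness of `R'` lets that supremum pass through the infimum, as in Dini's theorem;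
this gives `minimax_energy`. Extreme points suffice because the energy is affine and lower
semicontinuous: Krein–Milman handles suprema (`biSup_Ex`), and the face of minimisers handles infima
(`biInf_Ex`). -/

open Topology Set

/-! ### Exchanging infima and directed suprema -/

section Dini

/-- A Dini-type exchange of infimum and directed supremum on a compact set. -/
theorem biInf_iSup_eq_iSup_biInf_of_directed {A ι : Type*} [TopologicalSpace A] [Nonempty ι]
    {S : Set A} (hS : IsCompact S) {g : ι → A → ℝ≥0∞} (hg : Directed (· ≤ ·) g)
    (hlsc : ∀ i, LowerSemicontinuousOn (g i) S) :
    ⨅ x ∈ S, ⨆ i, g i x = ⨆ i, ⨅ x ∈ S, g i x := by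
  classical
  apply le_antisymm
  · refine le_of_forall_lt fun c hc => ?_
    -- The finite subfamily below yields only the weak bound by `d`; `c < d` restores strictness.
    obtain ⟨d, hcd, hd⟩ := exists_between hc
    have key : ∃ s : Finset (univ : Set ι), ∀ x ∈ S, ∃ i ∈ s, d < g i x := by
      rw [← LowerSemicontinuousOn.inter_biInter_preimage_Iic_eq_empty_iff_exists_finset hS
        (fun i _ => hlsc i)]
      apply Set.eq_empty_of_forall_notMem
      rintro x ⟨hx, hx'⟩
      simp only [mem_iInter, mem_preimage, mem_Iic] at hx'
      exact hd.not_ge ((biInf_le _ hx).trans (iSup_le fun i => hx' i (mem_univ i)))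
    obtain ⟨s, hs⟩ := key
    obtain ⟨j, hj⟩ := hg.finset_le (s.image Subtype.val)
    refine hcd.trans_le (le_iSup_of_le j (le_iInf₂ fun x hx => ?_))
    obtain ⟨i, his, hi⟩ := hs x hx
    exact hi.le.trans (hj i (Finset.mem_image_of_mem _ his) x)
  · exact iSup_le fun i => iInf₂_mono fun x _ => le_iSup (fun i => g i x) i

end Dini

/-! ### Radon measures as functionals; reduction to extreme points -/

section Functional

variable {X : Type*} [TopologicalSpace X] [T2Space X] [MeasurableSpace X] [BorelSpace X]

instance (μ : RadonMeasure X) : IsFiniteMeasure (μ : Measure X) := μ.2.1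

instance (μ : RadonMeasure X) : (μ : Measure X).Regular := μ.2.2

/-- A Radon measure as a functional on `C_c(X, ℝ)`. -/
noncomputable def integralMap (X : Type*) [TopologicalSpace X] [T2Space X] [MeasurableSpace X]
    [BorelSpace X] : RadonMeasure X →ₗ[ℝ≥0] (C_c(X, ℝ) → ℝ) where
  toFun μ f := ∫ x, f x ∂(μ : Measure X)
  map_add' μ ν := by
    ext f
    exact integral_add_measure f.integrable f.integrable
  map_smul' c μ := by
    ext f
    exact integral_smul_nnreal_measure _ c

/-- Inducing by definition of the vague topology, injective by uniqueness in the Riesz theorem. It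
moves the cone of measures into a real locally convex space, where Krein–Milman and Sion apply. -/
theorem isEmbedding_integralMap [LocallyCompactSpace X] : IsEmbedding (integralMap X) :=
  ⟨⟨rfl⟩, fun _ _ h =>
    Subtype.ext (Measure.ext_of_integral_eq_on_compactlySupported fun f => congrFun h f)⟩

theorem convex_image_integralMap {R : Set (RadonMeasure X)} (hR : Convex ℝ≥0 R) :
    Convex ℝ (integralMap X '' R) := by
  rintro _ ⟨μ, hμ, rfl⟩ _ ⟨ν, hν, rfl⟩ a b ha hb hab
  lift a to ℝ≥0 using ha
  lift b to ℝ≥0 using hb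
  refine ⟨a • μ + b • ν, hR hμ hν zero_le zero_le (by exact_mod_cast hab), ?_⟩
  rw [map_add, map_smul, map_smul]
  rfl

theorem extremePoints_image_integralMap [LocallyCompactSpace X] (R : Set (RadonMeasure X)) :
    (integralMap X '' R).extremePoints ℝ = integralMap X '' Ex R := by
  have hinj := (isEmbedding_integralMap (X := X)).injective
  apply Subset.antisymm
  · rintro _ ⟨⟨μ, hμ, rfl⟩, h⟩
    refine ⟨μ, ⟨hμ, fun μ₁ h₁ μ₂ h₂ => ?_⟩, rfl⟩
    rintro ⟨a, b, ha, hb, hab, rfl⟩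
    refine hinj (h ⟨_, h₁, rfl⟩ ⟨_, h₂, rfl⟩
      ⟨a, b, by exact_mod_cast ha, by exact_mod_cast hb, by exact_mod_cast hab, ?_⟩)
    rw [map_add, map_smul, map_smul]
    rfl
  · rintro _ ⟨μ, ⟨hμ, h⟩, rfl⟩
    refine ⟨⟨μ, hμ, rfl⟩, ?_⟩
    rintro _ ⟨μ₁, h₁, rfl⟩ _ ⟨μ₂, h₂, rfl⟩ ⟨a, b, ha, hb, hab, heq⟩
    lift a to ℝ≥0 using ha.le
    lift b to ℝ≥0 using hb.le
    refine congrArg _ (h h₁ h₂ ⟨a, b, by exact_mod_cast ha, by exact_mod_cast hb,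
      by exact_mod_cast hab, hinj ?_⟩)
    rw [← heq, map_add, map_smul, map_smul]
    rfl

theorem Ex_nonempty [LocallyCompactSpace X] {R : Set (RadonMeasure X)} (hR : IsCompact R)
    (hne : R.Nonempty) : (Ex R).Nonempty := by
  have h := (hR.image isEmbedding_integralMap.continuous).extremePoints_nonempty (hne.image _)
  rw [extremePoints_image_integralMap] at h
  exact image_nonempty.1 h

/-- **Krein–Milman**: a closed convex set of Radon measures containing the extreme points of a
compact convex set contains that set. -/
theorem subset_of_Ex_subset [LocallyCompactSpace X] {R C : Set (RadonMeasure X)}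
    (hR : IsCompact R) (hRc : Convex ℝ≥0 R) (hC : IsClosed C) (hCc : Convex ℝ≥0 C)
    (h : Ex R ⊆ C) : R ⊆ C := by
  have hcont := (isEmbedding_integralMap (X := X)).continuous
  have hKM := closure_convexHull_extremePoints (hR.image hcont) (convex_image_integralMap hRc)
  have hsub : integralMap X '' R ⊆ integralMap X '' (R ∩ C) := by
    rw [← hKM, extremePoints_image_integralMap]
    refine closure_minimal (convexHull_min (image_mono fun μ hμ => ⟨hμ.1, h hμ⟩)
      (convex_image_integralMap (hRc.inter hCc))) ((hR.inter_right hC).image hcont).isClosed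
  intro μ hμ
  obtain ⟨ν, hν, hνμ⟩ := hsub ⟨μ, hμ, rfl⟩
  exact isEmbedding_integralMap.injective hνμ ▸ hν.2

/-- `g` respects combinations with nonnegative coefficients. -/
def IsConic (g : RadonMeasure X → ℝ≥0∞) : Prop :=
  ∀ (a b : ℝ≥0) (μ ν : RadonMeasure X), g (a • μ + b • ν) = a * g μ + b * g ν

theorem IsConic.convex_le {g : RadonMeasure X → ℝ≥0∞} (hg : IsConic g) (r : ℝ≥0∞) :
    Convex ℝ≥0 {μ | g μ ≤ r} := by
  intro μ hμ ν hν a b _ _ hab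
  simp only [mem_ofPred_eq] at *
  rw [hg]
  calc a * g μ + b * g ν ≤ a * r + b * r := by gcongr
    _ = r := by rw [← add_mul, ← ENNReal.coe_add, hab]; simp

theorem IsConic.convex_ge {g : RadonMeasure X → ℝ≥0∞} (hg : IsConic g) (r : ℝ≥0∞) :
    Convex ℝ≥0 {μ | r ≤ g μ} := by
  intro μ hμ ν hν a b _ _ hab
  simp only [mem_ofPred_eq] at *
  rw [hg]
  calc r = a * r + b * r := by rw [← add_mul, ← ENNReal.coe_add, hab]; simp
    _ ≤ a * g μ + b * g ν := by gcongr

/-- The sublevel set of `g` at its supremum over `Ex R` is closed, convex and contains `Ex R`, hence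
contains `R`. -/
theorem biSup_Ex [LocallyCompactSpace X] {R : Set (RadonMeasure X)} (hR : IsCompact R)
    (hRc : Convex ℝ≥0 R) {g : RadonMeasure X → ℝ≥0∞} (hg : IsConic g)
    (hlsc : LowerSemicontinuous g) : ⨆ μ ∈ Ex R, g μ = ⨆ μ ∈ R, g μ := by
  apply le_antisymm (biSup_mono fun μ hμ => hμ.1)
  refine iSup₂_le fun μ hμ => ?_
  exact subset_of_Ex_subset hR hRc (hlsc.isClosed_preimage (⨆ μ ∈ Ex R, g μ)) (hg.convex_le _)
    (fun ν hν => le_biSup g hν) hμ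

/-- When the minimum is finite, the minimisers form a nonempty compact extreme subset of `R`, and
its extreme points are extreme in `R`. -/
theorem biInf_Ex [LocallyCompactSpace X] {R : Set (RadonMeasure X)} (hR : IsCompact R)
    (hne : R.Nonempty) {g : RadonMeasure X → ℝ≥0∞} (hg : IsConic g)
    (hlsc : LowerSemicontinuous g) : ⨅ μ ∈ Ex R, g μ = ⨅ μ ∈ R, g μ := by
  refine le_antisymm ?_ (biInf_mono fun μ hμ => hμ.1)
  obtain ⟨m, hm, hmin⟩ := (hlsc.lowerSemicontinuousOn R).exists_isMinOn hne hR
  refine le_iInf₂ fun μ hμ => le_trans ?_ (hmin hμ)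
  -- Finiteness of the minimum is what allows `b * g m` to be cancelled.
  rcases eq_or_ne (g m) ∞ with htop | hfin
  · rw [htop]
    exact le_top
  have hface : IsExtreme ℝ≥0 R (R ∩ {μ | g μ ≤ g m}) := by
    refine ⟨inter_subset_left, ?_⟩
    rintro μ₁ h₁ μ₂ h₂ _ ⟨-, hle⟩ ⟨a, b, ha, hb, hab, rfl⟩
    refine ⟨h₁, ?_⟩
    simp only [mem_ofPred_eq] at hle ⊢
    rw [hg] at hle
    have h2 : g m ≤ g μ₂ := hmin h₂
    have hsplit : g m = a * g m + b * g m := by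
      rw [← add_mul, ← ENNReal.coe_add, hab]; simp
    have h3 : a * g μ₁ + b * g m ≤ a * g m + b * g m := by
      rw [← hsplit]
      exact le_trans (by gcongr) hle
    have h4 := (ENNReal.add_le_add_iff_right (ENNReal.mul_ne_top ENNReal.coe_ne_top hfin)).1 h3
    exact (ENNReal.mul_le_mul_iff_right (by simpa using ha.ne') ENNReal.coe_ne_top).1 h4
  obtain ⟨ν, hν⟩ := Ex_nonempty (hR.inter_right (hlsc.isClosed_preimage (g m))) ⟨m, hm, le_refl (g m)⟩
  exact iInf₂_le_of_le ν (hface.extremePoints_subset_extremePoints hν) hν.1.2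

end Functional

/-! ### Pairings with test functions and the energy -/

section Pairing

variable {X Y : Type*} [TopologicalSpace X] [T2Space X] [MeasurableSpace X] [BorelSpace X]
  [TopologicalSpace Y] [T2Space Y] [MeasurableSpace Y] [BorelSpace Y]

/-- The integral of a test function against the product of two Radon measures. -/
noncomputable def pairing (h : C_c(X × Y, ℝ)) (μ : RadonMeasure X) (ν : RadonMeasure Y) : ℝ≥0∞ :=
  ∫⁻ z, ENNReal.ofReal (h z) ∂((μ : Measure X).prod (ν : Measure Y))

/-- The continuous compactly supported functions `h` with `0 ≤ h ≤ k`. -/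
def Minorant (k : X × Y → ℝ≥0∞) : Type _ :=
  {h : C_c(X × Y, ℝ) // ∀ z, 0 ≤ h z ∧ ENNReal.ofReal (h z) ≤ k z}

theorem energy_eq_iSup_pairing (k : X × Y → ℝ≥0∞) (μ : RadonMeasure X) (ν : RadonMeasure Y) :
    energy k μ ν = ⨆ h : Minorant k, pairing h.1 μ ν :=
  iSup_subtype'

instance (k : X × Y → ℝ≥0∞) : Nonempty (Minorant k) :=
  ⟨⟨0, fun z => by simp⟩⟩

/-- The pointwise maximum works, and it serves all pairs of measures at once. -/
theorem directed_pairing (k : X × Y → ℝ≥0∞) (h₁ h₂ : Minorant k) :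
    ∃ h : Minorant k, ∀ μ ν, pairing h₁.1 μ ν ≤ pairing h.1 μ ν ∧
      pairing h₂.1 μ ν ≤ pairing h.1 μ ν := by
  refine ⟨⟨h₁.1 ⊔ h₂.1, fun z => ⟨?_, ?_⟩⟩, fun μ ν => ⟨?_, ?_⟩⟩
  · exact (h₁.2 z).1.trans le_sup_left
  · simpa using ⟨(h₁.2 z).2, (h₂.2 z).2⟩
  · exact lintegral_mono fun z => ENNReal.ofReal_le_ofReal le_sup_left
  · exact lintegral_mono fun z => ENNReal.ofReal_le_ofReal le_sup_right

/-- A test function with its variables exchanged. -/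
def swapTest (h : C_c(X × Y, ℝ)) : C_c(Y × X, ℝ) :=
  ⟨⟨fun z => h z.swap, h.continuous.comp continuous_swap⟩,
    h.hasCompactSupport.comp_homeomorph (Homeomorph.prodComm Y X)⟩

theorem pairing_swapTest (h : C_c(X × Y, ℝ)) (μ : RadonMeasure X) (ν : RadonMeasure Y) :
    pairing (swapTest h) ν μ = pairing h μ ν :=
  lintegral_prod_swap (μ := (μ : Measure X)) (ν := (ν : Measure Y)) fun z => ENNReal.ofReal (h z)

theorem energy_swap_le (k : X × Y → ℝ≥0∞) (μ : RadonMeasure X) (ν : RadonMeasure Y) :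
    energy k μ ν ≤ energy (fun z : Y × X => k (z.2, z.1)) ν μ := by
  refine iSup₂_le fun h hh => ?_
  refine le_trans (pairing_swapTest h μ ν).ge (le_iSup₂_of_le (swapTest h) ?_ le_rfl)
  exact fun z => hh z.swap

theorem energy_swap (k : X × Y → ℝ≥0∞) (μ : RadonMeasure X) (ν : RadonMeasure Y) :
    energy (fun z : Y × X => k (z.2, z.1)) ν μ = energy k μ ν :=
  le_antisymm (energy_swap_le (fun z : Y × X => k (z.2, z.1)) ν μ) (energy_swap_le k μ ν)

theorem isConic_pairing (h : C_c(X × Y, ℝ)) (μ : RadonMeasure X) : IsConic (pairing h μ) := by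
  intro a b ν ν'
  have hprod : (μ : Measure X).prod ((a • ν + b • ν' : RadonMeasure Y) : Measure Y) =
      a • (μ : Measure X).prod (ν : Measure Y) + b • (μ : Measure X).prod (ν' : Measure Y) := by
    rw [Submodule.coe_add, Submodule.coe_smul, Submodule.coe_smul, Measure.prod_add,
      Measure.prod_smul_right, Measure.prod_smul_right]
  simp only [pairing, hprod, lintegral_add_measure, lintegral_smul_measure, ENNReal.smul_def,
    smul_eq_mul]

theorem isConic_pairing_left (h : C_c(X × Y, ℝ)) (ν : RadonMeasure Y) :
    IsConic fun μ => pairing h μ ν := by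
  simpa only [← pairing_swapTest h] using isConic_pairing (swapTest h) ν

theorem isConic_energy (k : X × Y → ℝ≥0∞) (μ : RadonMeasure X) : IsConic (energy k μ) := by
  intro a b ν ν'
  simp only [energy_eq_iSup_pairing, isConic_pairing _ μ a b ν ν', ENNReal.mul_iSup]
  -- Directedness makes the sum of two suprema a supremum over a single `h`.
  refine (ENNReal.iSup_add_iSup fun h₁ h₂ => ?_).symm
  obtain ⟨h, hh⟩ := directed_pairing k h₁ h₂
  refine ⟨h, ?_⟩
  gcongr
  exacts [(hh μ ν).1, (hh μ ν').2]

/-- The partial integral of a test function against a Radon measure. -/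
noncomputable def partialIntegral (h : C_c(X × Y, ℝ)) (μ : RadonMeasure X) : C_c(Y, ℝ) where
  toFun y := ∫ x, h (x, y) ∂(μ : Measure X)
  continuous_toFun := by
    rw [← continuousOn_univ]
    refine continuousOn_integral_of_compact_support (f := fun y x => h (x, y))
      (h.hasCompactSupport.isCompact.image continuous_fst)
      (h.continuous.comp continuous_swap).continuousOn fun y x _ hx => ?_
    by_contra hne
    exact hx ⟨(x, y), subset_tsupport _ hne, rfl⟩
  hasCompactSupport' := by
    refine HasCompactSupport.intro (h.hasCompactSupport.isCompact.image continuous_snd)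
      fun y hy => ?_
    have hz : ∀ x, h (x, y) = 0 := fun x => by
      by_contra hne
      exact hy ⟨(x, y), subset_tsupport _ hne, rfl⟩
    simp [hz]

theorem pairing_eq_ofReal_integral {h : C_c(X × Y, ℝ)} (hh : ∀ z, 0 ≤ h z) (μ : RadonMeasure X)
    (ν : RadonMeasure Y) :
    pairing h μ ν = ENNReal.ofReal (integralMap Y ν (partialIntegral h μ)) := by
  -- Without second countability the product σ-algebra may be smaller than the Borel one; compact
  -- support gives measurability for it.
  have hmeas : Measurable h := h.hasCompactSupport.measurable_of_prod h.continuous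
  have hint (y : Y) : Integrable (fun x => h (x, y)) (μ : Measure X) := by
    refine Continuous.integrable_of_hasCompactSupport
      (h.continuous.comp (Continuous.prodMk_left y)) ?_
    refine HasCompactSupport.intro (h.hasCompactSupport.isCompact.image continuous_fst)
      fun x hx => ?_
    by_contra hne
    exact hx ⟨(x, y), subset_tsupport _ hne, rfl⟩
  calc pairing h μ ν
      = ∫⁻ y, ∫⁻ x, ENNReal.ofReal (h (x, y)) ∂(μ : Measure X) ∂(ν : Measure Y) :=
        lintegral_prod_symm _ hmeas.ennreal_ofReal.aemeasurable
    _ = ∫⁻ y, ENNReal.ofReal (partialIntegral h μ y) ∂(ν : Measure Y) :=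
        lintegral_congr fun y => (ofReal_integral_eq_lintegral_ofReal (hint y)
          (Filter.Eventually.of_forall fun x => hh (x, y))).symm
    _ = _ := (ofReal_integral_eq_lintegral_ofReal (partialIntegral h μ).integrable
          (Filter.Eventually.of_forall fun y => integral_nonneg fun x => hh (x, y))).symm

theorem continuous_pairing {h : C_c(X × Y, ℝ)} (hh : ∀ z, 0 ≤ h z) (μ : RadonMeasure X) :
    Continuous (pairing h μ) := by
  have hc : Continuous (integralMap Y) := continuous_induced_dom
  rw [funext (pairing_eq_ofReal_integral hh μ)]
  exact ENNReal.continuous_ofReal.comp ((continuous_apply _).comp hc)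

theorem continuous_pairing_left {h : C_c(X × Y, ℝ)} (hh : ∀ z, 0 ≤ h z) (ν : RadonMeasure Y) :
    Continuous fun μ => pairing h μ ν := by
  simpa only [← pairing_swapTest h] using
    continuous_pairing (h := swapTest h) (fun z => hh z.swap) ν

theorem lowerSemicontinuous_energy (k : X × Y → ℝ≥0∞) (μ : RadonMeasure X) :
    LowerSemicontinuous (energy k μ) := by
  rw [funext (energy_eq_iSup_pairing k μ)]
  exact lowerSemicontinuous_iSup fun h =>
    (continuous_pairing (fun z => (h.2 z).1) μ).lowerSemicontinuous

end Pairing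

/-! ### Minimax and the conclusion -/

section Minimax

variable {X Y : Type*}
  [TopologicalSpace X] [T2Space X] [LocallyCompactSpace X] [MeasurableSpace X] [BorelSpace X]
  [TopologicalSpace Y] [T2Space Y] [LocallyCompactSpace Y] [MeasurableSpace Y] [BorelSpace Y]

theorem sep_image_invFun {A B : Type*} [Nonempty A] {e : A → B}
    (he : Function.LeftInverse (Function.invFun e) e) (S : Set A) (P : A → Prop) :
    {b | b ∈ e '' S ∧ P (Function.invFun e b)} = e '' (S ∩ {a | P a}) := by
  ext b
  constructor
  · rintro ⟨⟨a, ha, rfl⟩, h⟩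
    rw [he a] at h
    exact ⟨a, ⟨ha, h⟩, rfl⟩
  · rintro ⟨a, ⟨ha, h⟩, rfl⟩
    refine ⟨⟨a, ha, rfl⟩, ?_⟩
    rw [he a]
    exact h

/-- Sion's minimax theorem for sets of Radon measures. -/
theorem minimax_radonMeasure {R : Set (RadonMeasure X)} {R' : Set (RadonMeasure Y)}
    (hR : Convex ℝ≥0 R) (hR' : Convex ℝ≥0 R') (hne : R'.Nonempty) (hcpt : IsCompact R')
    {f : RadonMeasure X → RadonMeasure Y → ℝ≥0∞}
    (hc : ∀ μ, Continuous (f μ)) (hcl : ∀ ν, Continuous fun μ => f μ ν)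
    (hf : ∀ μ, IsConic (f μ)) (hfl : ∀ ν, IsConic fun μ => f μ ν) :
    ⨅ ν ∈ R', ⨆ μ ∈ R, f μ ν = ⨆ μ ∈ R, ⨅ ν ∈ R', f μ ν := by
  have eX := isEmbedding_integralMap (X := X)
  have eY := isEmbedding_integralMap (X := Y)
  have iX := Function.leftInverse_invFun eX.injective
  have iY := Function.leftInverse_invFun eY.injective
  have cX : ContinuousOn (Function.invFun (integralMap X)) (range (integralMap X)) := by
    rw [← image_univ, eX.isInducing.continuousOn_image_iff, iX.comp_eq_id]
    exact continuousOn_id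
  have cY : ContinuousOn (Function.invFun (integralMap Y)) (range (integralMap Y)) := by
    rw [← image_univ, eY.isInducing.continuousOn_image_iff, iY.comp_eq_id]
    exact continuousOn_id
  -- Sion is applied to the images in real function spaces; the values of `Function.invFun` off the
  -- ranges play no role.
  have key := Sion.minimax' (X := integralMap Y '' R') (Y := integralMap X '' R)
    (f := fun q p => f (Function.invFun (integralMap X) p) (Function.invFun (integralMap Y) q))
    (hne.image _) (convex_image_integralMap hR') (hcpt.image eY.continuous)
    (fun p _ => (((hc _).comp_continuousOn cY).mono (image_subset_range _ _)).lowerSemicontinuousOn)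
    (fun p _ r => by
      rw [sep_image_invFun iY R' fun ν => f (Function.invFun (integralMap X) p) ν ≤ r]
      exact convex_image_integralMap (hR'.inter ((hf _).convex_le r)))
    (convex_image_integralMap hR)
    (fun q _ => (((hcl _).comp_continuousOn cX).mono (image_subset_range _ _)).upperSemicontinuousOn)
    (fun q _ r => by
      rw [sep_image_invFun iX R fun μ => r ≤ f μ (Function.invFun (integralMap Y) q)]
      exact convex_image_integralMap (hR.inter ((hfl _).convex_ge r)))
  simpa only [iInf_image, iSup_image, iX _, iY _] using key

/-- Sion asks for upper semicontinuity in the maximised variable, but the energy is in general only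
lower semicontinuous. Hence the detour through the continuous pairings, with a Dini exchange before
and after. -/
theorem minimax_energy (k : X × Y → ℝ≥0∞) {R : Set (RadonMeasure X)} {R' : Set (RadonMeasure Y)}
    (hR : Convex ℝ≥0 R) (hR' : Convex ℝ≥0 R') (hne : R'.Nonempty) (hcpt : IsCompact R') :
    ⨅ ν ∈ R', ⨆ μ ∈ R, energy k μ ν = ⨆ μ ∈ R, ⨅ ν ∈ R', energy k μ ν := by
  have hdir (μ : RadonMeasure X) :
      Directed (· ≤ ·) fun h : Minorant k => pairing h.1 μ := fun h₁ h₂ => by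
    obtain ⟨h, hh⟩ := directed_pairing k h₁ h₂
    exact ⟨h, fun ν => (hh μ ν).1, fun ν => (hh μ ν).2⟩
  have hdir' : Directed (· ≤ ·) fun (h : Minorant k) ν => ⨆ μ ∈ R, pairing h.1 μ ν :=
    fun h₁ h₂ => by
      obtain ⟨h, hh⟩ := directed_pairing k h₁ h₂
      exact ⟨h, fun ν => iSup₂_mono fun μ _ => (hh μ ν).1,
        fun ν => iSup₂_mono fun μ _ => (hh μ ν).2⟩
  have hcont (h : Minorant k) (μ : RadonMeasure X) := continuous_pairing (fun z => (h.2 z).1) μ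
  calc ⨅ ν ∈ R', ⨆ μ ∈ R, energy k μ ν
      = ⨅ ν ∈ R', ⨆ h : Minorant k, ⨆ μ ∈ R, pairing h.1 μ ν := by
        refine biInf_congr fun ν _ => ?_
        simp only [energy_eq_iSup_pairing]
        rw [iSup_comm]
        refine iSup_congr fun μ => iSup_comm
    _ = ⨆ h : Minorant k, ⨅ ν ∈ R', ⨆ μ ∈ R, pairing h.1 μ ν :=
        biInf_iSup_eq_iSup_biInf_of_directed hcpt hdir' fun h =>
          (lowerSemicontinuous_biSup fun μ _ =>
            (hcont h μ).lowerSemicontinuous).lowerSemicontinuousOn _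
    _ = ⨆ h : Minorant k, ⨆ μ ∈ R, ⨅ ν ∈ R', pairing h.1 μ ν :=
        iSup_congr fun h => minimax_radonMeasure hR hR' hne hcpt (hcont h)
          (continuous_pairing_left fun z => (h.2 z).1) (isConic_pairing h.1)
          (isConic_pairing_left h.1)
    _ = ⨆ μ ∈ R, ⨆ h : Minorant k, ⨅ ν ∈ R', pairing h.1 μ ν := by
        rw [iSup_comm]
        exact iSup_congr fun μ => iSup_comm
    _ = ⨆ μ ∈ R, ⨅ ν ∈ R', energy k μ ν := by
        refine biSup_congr fun μ _ => ?_
        simp only [energy_eq_iSup_pairing]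
        exact (biInf_iSup_eq_iSup_biInf_of_directed hcpt (hdir μ) fun h =>
          (hcont h μ).lowerSemicontinuous.lowerSemicontinuousOn _).symm

theorem lowerQ_Ex_eq_upperQ_Ex (k : X × Y → ℝ≥0∞) {R : Set (RadonMeasure X)}
    {R' : Set (RadonMeasure Y)} (hne : R'.Nonempty) (hR : IsCompact R) (hR' : IsCompact R')
    (hRc : Convex ℝ≥0 R) (hRc' : Convex ℝ≥0 R') :
    lowerQ k R (Ex R') = upperQ (fun z : Y × X => k (z.2, z.1)) R' (Ex R) :=
  calc lowerQ k R (Ex R')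
      = ⨆ μ ∈ R, ⨅ ν ∈ R', energy k μ ν :=
        biSup_congr fun μ _ =>
          biInf_Ex hR' hne (isConic_energy k μ) (lowerSemicontinuous_energy k μ)
    _ = ⨅ ν ∈ R', ⨆ μ ∈ R, energy k μ ν := (minimax_energy k hRc hRc' hne hR').symm
    _ = ⨅ ν ∈ R', ⨆ μ ∈ R, energy (fun z : Y × X => k (z.2, z.1)) ν μ := by
        simp only [energy_swap]
    _ = upperQ (fun z : Y × X => k (z.2, z.1)) R' (Ex R) :=
        biInf_congr fun ν _ =>
          (biSup_Ex hR hRc (isConic_energy _ ν) (lowerSemicontinuous_energy _ ν)).symm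

theorem lowerQ_Ex_eq_upperQ_Ex_of_symm {k : X × X → ℝ≥0∞} (hk : ∀ x y, k (x, y) = k (y, x))
    {R R' : Set (RadonMeasure X)} (hne : R'.Nonempty) (hR : IsCompact R) (hR' : IsCompact R')
    (hRc : Convex ℝ≥0 R) (hRc' : Convex ℝ≥0 R') :
    lowerQ k R (Ex R') = upperQ k R' (Ex R) := by
  rw [lowerQ_Ex_eq_upperQ_Ex k hne hR hR' hRc hRc',
    show (fun z : X × X => k (z.2, z.1)) = k from funext fun z => hk z.2 z.1]

end Minimax

end SetEnergy

theorem corollary1 {X Y : Type*}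
    [TopologicalSpace X] [T2Space X] [LocallyCompactSpace X] [MeasurableSpace X] [BorelSpace X]
    [TopologicalSpace Y] [T2Space Y] [LocallyCompactSpace Y] [MeasurableSpace Y] [BorelSpace Y] :
    -- symmetric kernel on `X × X`, compact `H, L ⊆ X`
    (∀ k : X × X → ℝ≥0∞, LowerSemicontinuous k → (∀ x y, k (x, y) = k (y, x)) →
      ∀ H L : Set X, IsCompact H → IsCompact L →
      ∀ R R' : Set (RadonMeasure X), R ⊆ measuresOn H → R' ⊆ measuresOn L →
        R.Nonempty → R'.Nonempty → IsCompact R → IsCompact R' → Convex ℝ≥0 R → Convex ℝ≥0 R' →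
        lowerQ k R (Ex R') = upperQ k R' (Ex R)) ∧
    -- compact sets `H ⊆ X`, `L ⊆ Y` in two spaces and a kernel on `X × Y`
    (∀ k : X × Y → ℝ≥0∞, LowerSemicontinuous k →
      ∀ (H : Set X) (L : Set Y), IsCompact H → IsCompact L →
      ∀ (R : Set (RadonMeasure X)) (R' : Set (RadonMeasure Y)),
        R ⊆ measuresOn H → R' ⊆ measuresOn L →
        R.Nonempty → R'.Nonempty → IsCompact R → IsCompact R' → Convex ℝ≥0 R → Convex ℝ≥0 R' →
        lowerQ k R (Ex R') = upperQ (fun z : Y × X => k (z.2, z.1)) R' (Ex R)) ∧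
    -- the case of one set of measures
    (∀ k : X × X → ℝ≥0∞, LowerSemicontinuous k → (∀ x y, k (x, y) = k (y, x)) →
      ∀ H : Set X, IsCompact H →
      ∀ R : Set (RadonMeasure X), R ⊆ measuresOn H →
        R.Nonempty → IsCompact R → Convex ℝ≥0 R →
        lowerQ k R (Ex R) = upperQ k R (Ex R)) := by

  refine ⟨?_, ?_, ?_⟩
  · intro k _ hsymm H L _ _ R R' _ _ _ hne hR hR' hRc hRc'
    exact lowerQ_Ex_eq_upperQ_Ex_of_symm hsymm hne hR hR' hRc hRc'
  · intro k _ H L _ _ R R' _ _ _ hne hR hR' hRc hRc'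
    exact lowerQ_Ex_eq_upperQ_Ex k hne hR hR' hRc hRc'
  · intro k _ hsymm H _ R _ hne hR hRc
    exact lowerQ_Ex_eq_upperQ_Ex_of_symm hsymm hne hR hR hRc hRc
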